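/- Let $U\subseteq\mathbb R$ be open. A little-oh polynomial on $U$ is a function $x:[0,\epsilon)\to U$, for some $\epsilon>0$, such that $x(t)=x(0)+\sum_{i=1}^{k}\alpha_i t^{a_i}+o(t)$ as $t\to0^+$ for some $k\in\mathbb N$, $\alpha_i\in\mathbb R$ and $a_i>0$. Two little-oh polynomials $x,y$ on $U$ are equivalent if $x(0)=y(0)$ and $x(t)-y(t)=o(t)$ as $t\to0^+$; let ${}^\bullet U$ denote the set of equivalence classes, and regard ${}^\bullet U$ as a subset of the Fermat reals ${}^\bullet\mathbb R$. The standard part of $x\in{}^\bullet U$ is ${}^\circ x:=x(0)$. Any two elements $x,y\in{}^\bullet\mathbb R$ can be written with common exponents $0<a_1<\dots<a_n\le1$ as $x={}^\circ x+\sum_{i=1}^n\alpha_i t^{a_i}$ and $y={}^\circ y+\sum_{i=1}^n\beta_i t^{a_i}$ (zero coefficients allowed); put $x\le y$ if $({}^\circ x,\alpha_1,\dots,\alpha_n)\le({}^\circ y,\beta_1,\dots,\beta_n)$ in the dictionary order. This is a total order on ${}^\bullet\mathbb R$; $x<y$ means $x\le y$ and $x\ne y$. For a smooth function $f:U\to\mathbb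 R$, its Fermat extension ${}^\bullet f:{}^\bullet U\to{}^\bullet\mathbb R$ is the well-defined map given on representatives by ${}^\bullet f(x)=f\circ x$. **Corollary.** Let $U$ be an open connected subset of $\mathbb R$, and let $f:U\to\mathbb R$ be a smooth function without any flat point, i.e. for every $u\in U$ there exists an integer $m=m(u)>0$ such that $f^{(m)}(u)\neq0$. Then ${}^\bullet f:{}^\bullet U\to{}^\bullet\mathbb R$ has the intermediate value property: for all $a,b\in{}^\bullet U$ with $a<b$ and every $y\in{}^\bullet\mathbb R$ strictly between ${}^\bullet f(a)$ and ${}^\bullet f(b)$, there exists $c\in{}^\bullet U$ with $a<c<b$ such that ${}^\bullet f(c)=y$. -/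

import Mathlib

open Set Filter Topology Asymptotics
open scoped ContDiff

noncomputable section

namespace Fermat

/-- `x` is a little-oh polynomial on `U ⊆ ℝ`: it maps some `[0, ε)` with `ε > 0` into `U`, and
`x t = x 0 + ∑ i, α i * t ^ (a i) + o(t)` as `t → 0+`, for finitely many real coefficients `α i`
and real exponents `a i > 0`. The function is total only for convenience: its values off `[0, ε)`
play no role and are forgotten by the equivalence relation below. -/
def IsLittleOhPoly (U : Set ℝ) (x : ℝ → ℝ) : Prop :=
  (∃ ε : ℝ, 0 < ε ∧ ∀ t ∈ Ico (0 : ℝ) ε, x t ∈ U) ∧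
  ∃ (k : ℕ) (α a : Fin k → ℝ), (∀ i, 0 < a i) ∧
    (fun t : ℝ => x t - x 0 - ∑ i, α i * t ^ (a i)) =o[𝓝[>] (0 : ℝ)] (fun t : ℝ => t)

/-- The set `U₀[t]` of little-oh polynomials on `U`. -/
def LittleOhPoly (U : Set ℝ) : Type := {x : ℝ → ℝ // IsLittleOhPoly U x}

/-- Two little-oh polynomials are equivalent if they agree at `0` and differ by `o(t)`. -/
instance littleOhSetoid (U : Set ℝ) : Setoid (LittleOhPoly U) where
  r x y := x.1 0 = y.1 0 ∧
    (fun t : ℝ => x.1 t - y.1 t) =o[𝓝[>] (0 : ℝ)] (fun t : ℝ => t)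
  iseqv :=
    { refl := fun x => ⟨rfl, by simp⟩
      symm := fun {x y} h => ⟨h.1.symm, by simpa using h.2.neg_left⟩
      trans := fun {x y z} h₁ h₂ => ⟨h₁.1.trans h₂.1, by simpa using h₁.2.add h₂.2⟩ }

/-- The Fermat extension `•U` of `U ⊆ ℝ`. -/
def Ext (U : Set ℝ) : Type := Quotient (littleOhSetoid U)

/-- The Fermat reals `•ℝ`. -/
abbrev FermatReal : Type := Ext univ

/-- The standard part `°x`. -/
def std {U : Set ℝ} (x : Ext U) : ℝ :=
  Quotient.lift (s := littleOhSetoid U) (fun p : LittleOhPoly U => p.1 0) (fun _ _ h => And.left h) x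

/-- `x = °x + ∑ i, α i * t ^ (a i)` is a quasi-decomposition of `x`: the exponents satisfy
`0 < a 0 < a 1 < ⋯ ≤ 1`, and zero coefficients are allowed. -/
def IsQuasiDecomp {U : Set ℝ} (x : Ext U) {k : ℕ} (a α : Fin k → ℝ) : Prop :=
  StrictMono a ∧ (∀ i, a i ∈ Ioc (0 : ℝ) 1) ∧
  ∃ p : LittleOhPoly U, Quotient.mk (littleOhSetoid U) p = x ∧
    (fun t : ℝ => p.1 t - p.1 0 - ∑ i, α i * t ^ (a i)) =o[𝓝[>] (0 : ℝ)] (fun t : ℝ => t)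

/-- The order of `•ℝ` (and of `•U ⊆ •ℝ`): compare `(°x, α₁, …, αₖ)` and `(°y, β₁, …, βₖ)` in the
dictionary order, for quasi-decompositions of `x` and `y` with the same exponents. -/
instance (U : Set ℝ) : LE (Ext U) where
  le x y := ∃ (k : ℕ) (a α β : Fin k → ℝ), IsQuasiDecomp x a α ∧ IsQuasiDecomp y a β ∧
    toLex (Fin.cons (std x) α : Fin (k + 1) → ℝ) ≤ toLex (Fin.cons (std y) β : Fin (k + 1) → ℝ)

instance (U : Set ℝ) : LT (Ext U) where
  lt x y := x ≤ y ∧ x ≠ y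

/-! The composite of a smooth function with a little-oh polynomial is a little-oh polynomial, and
its class depends only on the class of the latter. -/

/-- The algebra generated by the functions `|t| ^ a`, `a > 0`. -/
def powAlg : Subalgebra ℝ (ℝ → ℝ) :=
  Algebra.adjoin ℝ {g | ∃ a : ℝ, 0 < a ∧ g = fun t => |t| ^ a}

theorem powAlg_normal_form {g : ℝ → ℝ} (hg : g ∈ powAlg) :
    ∃ (c : ℝ) (k : ℕ) (α a : Fin k → ℝ), (∀ i, 0 < a i) ∧
      ∀ t, g t = c + ∑ i, α i * |t| ^ (a i) := by
  have hg' : g ∈ Subalgebra.toSubmodule powAlg := hg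
  rw [powAlg, Algebra.adjoin_eq_span, Submodule.mem_span_set'] at hg'
  obtain ⟨n, f, e, rfl⟩ := hg'
  have key : ∀ i, (e i : ℝ → ℝ) = 1 ∨ ∃ a : ℝ, 0 < a ∧ (e i : ℝ → ℝ) = fun t => |t| ^ a := by
    intro i
    refine Submonoid.closure_induction
      (motive := fun (h : ℝ → ℝ) _ => h = 1 ∨ ∃ a : ℝ, 0 < a ∧ h = fun t => |t| ^ a)
      (fun h hh => Or.inr hh) (Or.inl rfl) ?_ (e i).2
    rintro h₁ h₂ - - (rfl | ⟨a, ha, rfl⟩) (rfl | ⟨b, hb, rfl⟩)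
    · left; simp
    · right; exact ⟨b, hb, by simp⟩
    · right; exact ⟨a, ha, by simp⟩
    · right
      refine ⟨a + b, by positivity, ?_⟩
      funext t
      exact (Real.rpow_add_of_nonneg (abs_nonneg t) ha.le hb.le).symm
  have key' : ∀ i, ∃ (c d a : ℝ), 0 < a ∧ ∀ t, f i * (e i : ℝ → ℝ) t = c + d * |t| ^ a := by
    intro i
    rcases key i with h | ⟨a, ha, h⟩
    · exact ⟨f i, 0, 1, one_pos, fun t => by simp [h]⟩
    · exact ⟨0, f i, a, ha, fun t => by simp [h]⟩
  choose c d a ha h using key'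
  refine ⟨∑ i, c i, n, d, a, ha, fun t => ?_⟩
  rw [← Finset.sum_add_distrib]
  simp only [Finset.sum_apply, Pi.smul_apply, smul_eq_mul, h]

theorem tendsto_pow_sum {k : ℕ} (α a : Fin k → ℝ) (ha : ∀ i, 0 < a i) :
    Tendsto (fun t : ℝ => ∑ i, α i * t ^ (a i)) (𝓝[>] 0) (𝓝 0) := by
  have : Tendsto (fun t : ℝ => ∑ i, α i * t ^ (a i)) (𝓝 0) (𝓝 (∑ i, α i * (0 : ℝ) ^ (a i))) := by
    refine tendsto_finsetSum _ fun i _ => ?_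
    exact ((Real.continuousAt_rpow_const 0 (a i) (Or.inr (ha i).le)).tendsto).const_mul _
  simp only [Real.zero_rpow (ha _).ne', mul_zero, Finset.sum_const_zero] at this
  exact this.mono_left nhdsWithin_le_nhds

theorem tendsto_id_pos : Tendsto (fun t : ℝ => t) (𝓝[>] 0) (𝓝 0) :=
  tendsto_id.mono_left nhdsWithin_le_nhds

theorem powAlg_isBigO_one {g : ℝ → ℝ} (hg : g ∈ powAlg) :
    g =O[𝓝[>] (0 : ℝ)] (fun _ : ℝ => (1 : ℝ)) := by
  obtain ⟨c, k, α, a, ha, h⟩ := powAlg_normal_form hg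
  have h1 : Tendsto (fun t : ℝ => c + ∑ i, α i * t ^ (a i)) (𝓝[>] 0) (𝓝 (c + 0)) :=
    (tendsto_pow_sum α a ha).const_add c
  refine (h1.isBigO_one ℝ).congr' ?_ EventuallyEq.rfl
  filter_upwards [self_mem_nhdsWithin] with t ht
  rw [h t, abs_of_pos ht]

/-- Functions equal to an element of `powAlg` up to `o(t)`. -/
def approxAlg : Subalgebra ℝ (ℝ → ℝ) where
  carrier := {g | ∃ p ∈ powAlg, (fun t => g t - p t) =o[𝓝[>] (0 : ℝ)] (fun t : ℝ => t)}
  mul_mem' := by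
    rintro g h ⟨p, hp, hgp⟩ ⟨q, hq, hhq⟩
    refine ⟨p * q, mul_mem hp hq, ?_⟩
    have hone : (fun t : ℝ => t) =O[𝓝[>] (0 : ℝ)] (fun _ : ℝ => (1 : ℝ)) :=
      tendsto_id_pos.isBigO_one ℝ
    have e1 := hgp.mul_isBigO (powAlg_isBigO_one hq)
    have e2 := (powAlg_isBigO_one hp).mul_isLittleO hhq
    have e3 := hgp.mul_isBigO (hhq.isBigO.trans hone)
    simp only [mul_one, one_mul] at e1 e2 e3
    refine ((e1.add e2).add e3).congr_left fun t => ?_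
    simp only [Pi.mul_apply]
    ring
  add_mem' := by
    rintro g h ⟨p, hp, hgp⟩ ⟨q, hq, hhq⟩
    refine ⟨p + q, add_mem hp hq, (hgp.add hhq).congr_left fun t => ?_⟩
    simp only [Pi.add_apply]
    ring
  algebraMap_mem' := fun r =>
    ⟨algebraMap ℝ (ℝ → ℝ) r, Subalgebra.algebraMap_mem _ r, by simp⟩

theorem IsLittleOhPoly.tendsto {U : Set ℝ} {x : ℝ → ℝ} (hx : IsLittleOhPoly U x) :
    Tendsto x (𝓝[>] 0) (𝓝 (x 0)) := by
  obtain ⟨-, k, α, a, ha, h⟩ := hx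
  have h1 := ((h.trans_tendsto tendsto_id_pos).add (tendsto_pow_sum α a ha)).add_const (x 0)
  simpa using h1

theorem IsLittleOhPoly.mem_approxAlg {U : Set ℝ} {x : ℝ → ℝ} (hx : IsLittleOhPoly U x) :
    x ∈ approxAlg := by
  obtain ⟨-, k, α, a, ha, h⟩ := hx
  refine ⟨algebraMap ℝ (ℝ → ℝ) (x 0) + ∑ i, α i • (fun t : ℝ => |t| ^ (a i)), ?_, ?_⟩
  · refine add_mem (Subalgebra.algebraMap_mem _ _) (sum_mem fun i _ => ?_)
    have hmem : (fun t : ℝ => |t| ^ (a i)) ∈ powAlg := Algebra.subset_adjoin ⟨a i, ha i, rfl⟩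
    exact Subalgebra.smul_mem _ hmem _
  · refine h.congr' ?_ EventuallyEq.rfl
    filter_upwards [self_mem_nhdsWithin] with t ht
    simp [abs_of_pos (show (0 : ℝ) < t from ht), sub_sub, Finset.sum_apply]

theorem IsLittleOhPoly.exists_isBigO {U : Set ℝ} {x : ℝ → ℝ} (hx : IsLittleOhPoly U x) :
    ∃ n : ℕ, (fun t => (x t - x 0) ^ n) =O[𝓝[>] (0 : ℝ)] (fun t : ℝ => t) := by
  obtain ⟨-, k, α, a, ha, h⟩ := hx
  obtain ⟨δ, hδ, hδ1, hδa⟩ : ∃ δ : ℝ, 0 < δ ∧ δ ≤ 1 ∧ ∀ i, δ ≤ a i := by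
    have hfin : ∀ᶠ δ : ℝ in 𝓝[>] 0, ∀ i, δ ≤ a i := by
      rw [eventually_all]
      exact fun i => nhdsWithin_le_nhds (Iic_mem_nhds (ha i))
    have h1 : ∀ᶠ δ : ℝ in 𝓝[>] 0, δ ≤ 1 := nhdsWithin_le_nhds (Iic_mem_nhds one_pos)
    obtain ⟨δ, h⟩ := (hfin.and (h1.and self_mem_nhdsWithin)).exists
    exact ⟨δ, h.2.2, h.2.1, h.1⟩
  have hle : ∀ b : ℝ, δ ≤ b →
      (fun t : ℝ => t ^ b) =O[𝓝[>] (0 : ℝ)] (fun t : ℝ => t ^ δ) := by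
    intro b hb
    refine IsBigO.of_bound 1 ?_
    filter_upwards [Ioo_mem_nhdsGT (zero_lt_one' ℝ)] with t ht
    rw [Real.norm_of_nonneg (Real.rpow_nonneg ht.1.le _),
      Real.norm_of_nonneg (Real.rpow_nonneg ht.1.le _), one_mul]
    exact Real.rpow_le_rpow_of_exponent_ge ht.1 ht.2.le hb
  have hid : (fun t : ℝ => t) =O[𝓝[>] (0 : ℝ)] (fun t : ℝ => t ^ δ) := by
    simpa using hle 1 hδ1
  have hsum : (fun t : ℝ => ∑ i, α i * t ^ (a i)) =O[𝓝[>] (0 : ℝ)] (fun t : ℝ => t ^ δ) :=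
    IsBigO.fun_sum fun i _ => (hle (a i) (hδa i)).const_mul_left _
  have hx : (fun t => x t - x 0) =O[𝓝[>] (0 : ℝ)] (fun t : ℝ => t ^ δ) := by
    simpa using (h.isBigO.trans hid).add hsum
  obtain ⟨n, hn⟩ := exists_nat_gt (1 / δ)
  refine ⟨n, (hx.pow n).trans (IsBigO.of_bound 1 ?_)⟩
  filter_upwards [Ioo_mem_nhdsGT (zero_lt_one' ℝ)] with t ht
  rw [← Real.rpow_mul_natCast ht.1.le, Real.norm_of_nonneg (Real.rpow_nonneg ht.1.le _),
    Real.norm_of_nonneg ht.1.le, one_mul]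
  have h1 : 1 ≤ δ * n := by
    rw [div_lt_iff₀ hδ] at hn
    linarith
  simpa using Real.rpow_le_rpow_of_exponent_ge ht.1 ht.2.le h1

theorem IsLittleOhPoly.mem_zero {U : Set ℝ} {x : ℝ → ℝ} (hx : IsLittleOhPoly U x) : x 0 ∈ U := by
  obtain ⟨⟨ε, hε, h⟩, -⟩ := hx
  exact h 0 ⟨le_rfl, hε⟩

theorem IsLittleOhPoly.comp {U : Set ℝ} {f x : ℝ → ℝ} (hU : IsOpen U) (hf : ContDiffOn ℝ ∞ f U)
    (hx : IsLittleOhPoly U x) : IsLittleOhPoly univ (fun t => f (x t)) := by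
  refine ⟨⟨1, one_pos, fun _ _ => mem_univ _⟩, ?_⟩
  obtain ⟨ρ, hρ, hball⟩ := Metric.isOpen_iff.1 hU (x 0) hx.mem_zero
  set s := Metric.ball (x 0) ρ
  obtain ⟨n, hn⟩ := hx.exists_isBigO
  have hT := taylor_isLittleO (n := n) (convex_ball (x 0) ρ) (Metric.mem_ball_self hρ)
    ((hf.mono hball).of_le (by exact_mod_cast le_top))
  rw [Metric.isOpen_ball.nhdsWithin_eq (Metric.mem_ball_self hρ)] at hT
  have hT' := (hT.comp_tendsto hx.tendsto).trans_isBigO hn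
  have hmem : (fun t => taylorWithinEval f n s (x 0) (x t)) ∈ approxAlg := by
    have : (fun t => taylorWithinEval f n s (x 0) (x t)) =
        ∑ k ∈ Finset.range (n + 1), (iteratedDerivWithin k f s (x 0) * ((k.factorial : ℝ)⁻¹)) •
          (x - algebraMap ℝ (ℝ → ℝ) (x 0)) ^ k := by
      funext t
      rw [taylor_within_apply]
      simp only [Finset.sum_apply, Pi.smul_apply, smul_eq_mul, Pi.pow_apply, Pi.sub_apply,
        Pi.algebraMap_apply, Algebra.algebraMap_self, RingHom.id_apply]
      exact Finset.sum_congr rfl fun k _ => by ring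
    rw [this]
    exact sum_mem fun k _ => Subalgebra.smul_mem _
      (pow_mem (sub_mem hx.mem_approxAlg (Subalgebra.algebraMap_mem _ _)) k) _
  obtain ⟨p, hp, hgp⟩ := hmem
  obtain ⟨c, k, α, a, ha, hpt⟩ := powAlg_normal_form hp
  have hfin : (fun t => f (x t) - c - ∑ i, α i * t ^ (a i)) =o[𝓝[>] (0 : ℝ)]
      (fun t : ℝ => t) := by
    refine (hT'.add hgp).congr' ?_ EventuallyEq.rfl
    filter_upwards [self_mem_nhdsWithin] with t ht
    simp only [Function.comp_apply, hpt t, abs_of_pos (show (0 : ℝ) < t from ht)]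
    ring
  have hc : f (x 0) = c := by
    have h1 : Tendsto (fun t => f (x t)) (𝓝[>] 0) (𝓝 (f (x 0))) :=
      ((hf.continuousOn.continuousAt (hU.mem_nhds hx.mem_zero)).tendsto).comp hx.tendsto
    have h2 := ((hfin.trans_tendsto tendsto_id_pos).add (tendsto_pow_sum α a ha)).add_const c
    refine tendsto_nhds_unique h1 ?_
    simpa using h2
  exact ⟨k, α, a, ha, by simpa only [hc] using hfin⟩

theorem comp_equiv {U : Set ℝ} {f x y : ℝ → ℝ} (hU : IsOpen U) (hf : ContDiffOn ℝ ∞ f U)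
    (hx : IsLittleOhPoly U x) (hy : IsLittleOhPoly U y) (h0 : x 0 = y 0)
    (h : (fun t : ℝ => x t - y t) =o[𝓝[>] (0 : ℝ)] (fun t : ℝ => t)) :
    (fun t : ℝ => f (x t) - f (y t)) =o[𝓝[>] (0 : ℝ)] (fun t : ℝ => t) := by
  have hd : HasStrictDerivAt f (deriv f (x 0)) (x 0) :=
    (hf.contDiffAt (hU.mem_nhds hx.mem_zero)).hasStrictDerivAt (by simp)
  have hty : Tendsto y (𝓝[>] 0) (𝓝 (x 0)) := h0 ▸ hy.tendsto
  have := hd.hasStrictFDerivAt.isBigO_sub.comp_tendsto (hx.tendsto.prodMk_nhds hty)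
  exact this.trans_isLittleO h

/-- The Fermat extension `•f : •U → •ℝ`, `•f(x) = f ∘ x`, of a smooth function `f : U → ℝ` on an
open set `U ⊆ ℝ`. -/
def extend {U : Set ℝ} (f : ℝ → ℝ) (hU : IsOpen U) (hf : ContDiffOn ℝ ∞ f U) :
    Ext U → FermatReal :=
  Quotient.map (fun x : LittleOhPoly U => (⟨fun t => f (x.1 t), x.2.comp hU hf⟩ : LittleOhPoly univ))
    (fun x y h => ⟨congrArg f h.1, comp_equiv hU hf x.2 y.2 h.1 h.2⟩)

/-- The intermediate value property of a function `g : •U → •ℝ`. -/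
def HasIntermediateValueProperty {U : Set ℝ} (g : Ext U → FermatReal) : Prop :=
  ∀ a b : Ext U, a < b → ∀ y : FermatReal, (g a < y ∧ y < g b) ∨ (g b < y ∧ y < g a) →
    ∃ c : Ext U, a < c ∧ c < b ∧ g c = y

end Fermat

end

/-!
The strict order of the Fermat reals is a relation between germs at `0+`: the class of `x` is less
than that of `y` if and only if `y t - x t ≥ κ * t` for some `κ > 0` and all small `t > 0`
(`mk_lt_mk_iff`), and any two little-oh polynomials are comparable in this sense or equivalent
(`germ_trichotomy`). The germs are therefore tame: a relation `x t < y t`, or `x t = y t`, that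
holds for arbitrarily small `t > 0` already gives `x ≤ y`, or `x = y`, in `•ℝ`.

Let `y` lie strictly between `•f(a)` and `•f(b)`, and represent `y` by `y t = y₀ + ∑ αᵢ t ^ aᵢ`
without error term. For each small `t > 0` the real intermediate value theorem gives `c t`
strictly between `a t` and `b t` with `f (c t) = y t`. The function `c` may be irregular, but
along an ultrafilter finer than `𝓝[>] 0` it has a limit `c₀`, which lies in the interval `U`, and
`f c₀ = y₀`. As `f` is not flat at `c₀`, there is a smooth local coordinate `g` at `c₀` with
`|f x - f c₀| = |g x| ^ m` (`exists_power_chart`, from Hadamard's lemma and the inverse function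
theorem). Hence `g (c t) = ± |∑ αᵢ t ^ aᵢ| ^ (1 / m)`, where the root is a little-oh polynomial
(`exists_abs_rpow_sum_root`). Composing it with the inverse of `g` gives a little-oh polynomial
`C` equal to `c` along the ultrafilter, for one of the two signs (`exists_branch_of_power_chart`).

Thus `a t < C t < b t` and `f (C t) = y t` for arbitrarily small `t > 0`, and by tameness
`a ≤ C ≤ b` and `•f(C) = y` in `•ℝ`. Finally `C` is neither `a` nor `b`, as `y` is neither `•f(a)` nor
`•f(b)`.
-/

namespace Fermat

/-! ### Smooth division by `x - c` -/

section Hadamard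

variable {U : Set ℝ} {c : ℝ}

theorem lineMap_mem (hU : U.OrdConnected) (hc : c ∈ U) {x : ℝ} (hx : x ∈ U)
    {s : ℝ} (hs : s ∈ Icc (0 : ℝ) 1) : c + s * (x - c) ∈ U := by
  have := hU.convex.add_smul_sub_mem hc hx hs
  simpa using this

theorem continuousOn_moment (hU : U.OrdConnected) (hc : c ∈ U) {φ : ℝ → ℝ}
    (hφ : ContinuousOn φ U) (k : ℕ) {x : ℝ} (hx : x ∈ U) :
    ContinuousOn (fun s : ℝ => s ^ k * φ (c + s * (x - c))) (Icc 0 1) := by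
  refine (continuous_pow k).continuousOn.mul (hφ.comp (by fun_prop) fun s hs => ?_)
  exact lineMap_mem hU hc hx hs

/-- Differentiating `∫₀¹ sᵏ φ(c + s(y - c)) ds` under the integral sign gives an integral of the
same shape, with `k + 1` and `φ'`. Carrying the weight `sᵏ` is what makes smoothness an
induction. -/
theorem hasDerivAt_moment (hUo : IsOpen U) (hU : U.OrdConnected) (hc : c ∈ U) {φ : ℝ → ℝ}
    (hφ : ContDiffOn ℝ 1 φ U) (k : ℕ) {x : ℝ} (hx : x ∈ U) :
    HasDerivAt (fun y => ∫ s in (0 : ℝ)..1, s ^ k * φ (c + s * (y - c)))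
      (∫ s in (0 : ℝ)..1, s ^ (k + 1) * deriv φ (c + s * (x - c))) x := by
  obtain ⟨r, hr, hball⟩ := Metric.nhds_basis_closedBall.mem_iff.1 (hUo.mem_nhds hx)
  have hd : ContinuousOn (deriv φ) U := hφ.continuousOn_deriv_of_isOpen hUo le_rfl
  have hcont : ContinuousOn (fun q : ℝ × ℝ => q.1 ^ (k + 1) * deriv φ (c + q.1 * (q.2 - c)))
      (Icc 0 1 ×ˢ Metric.closedBall x r) := by
    refine ContinuousOn.mul (by fun_prop) (hd.comp (by fun_prop) fun q hq => ?_)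
    exact lineMap_mem hU hc (hball hq.2) hq.1
  obtain ⟨B, hB⟩ :=
    (isCompact_Icc.prod (isCompact_closedBall x r)).exists_bound_of_continuousOn hcont
  have hmeas : ∀ {ψ : ℝ → ℝ}, ContinuousOn ψ U → ∀ j : ℕ, ∀ {y : ℝ}, y ∈ U →
      IntervalIntegrable (fun s : ℝ => s ^ j * ψ (c + s * (y - c))) MeasureTheory.volume 0 1 := by
    intro ψ hψ j y hy
    apply ContinuousOn.intervalIntegrable
    rw [uIcc_of_le zero_le_one]
    exact continuousOn_moment hU hc hψ j hy
  have hs01 : ∀ {s : ℝ}, s ∈ uIoc (0 : ℝ) 1 → s ∈ Icc (0 : ℝ) 1 := fun hs => by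
    rw [uIoc_of_le zero_le_one] at hs
    exact Ioc_subset_Icc_self hs
  refine (intervalIntegral.hasDerivAt_integral_of_dominated_loc_of_deriv_le
    (F := fun y s => s ^ k * φ (c + s * (y - c)))
    (F' := fun y s => s ^ (k + 1) * deriv φ (c + s * (y - c)))
    (bound := fun _ => B) (Metric.ball_mem_nhds x hr) ?_ (hmeas hφ.continuousOn k hx)
    (hmeas hd (k + 1) hx).aestronglyMeasurable_restrict_uIoc ?_ intervalIntegrable_const ?_).2
  · filter_upwards [hUo.mem_nhds hx] with y hy
    exact (hmeas hφ.continuousOn k hy).aestronglyMeasurable_restrict_uIoc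
  · refine Eventually.of_forall fun s hs y hy => ?_
    exact hB (s, y) ⟨hs01 hs, Metric.ball_subset_closedBall hy⟩
  · refine Eventually.of_forall fun s hs y hy => ?_
    have hy' : c + s * (y - c) ∈ U :=
      lineMap_mem hU hc (hball (Metric.ball_subset_closedBall hy)) (hs01 hs)
    have h1 : HasDerivAt φ (deriv φ (c + s * (y - c))) (c + s * (y - c)) :=
      ((hφ.differentiableOn one_ne_zero).differentiableAt (hUo.mem_nhds hy')).hasDerivAt
    have h2 : HasDerivAt (fun y => c + s * (y - c)) s y := by
      simpa using (((hasDerivAt_id y).sub_const c).const_mul s).const_add c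
    refine ((h1.comp y h2).const_mul (s ^ k)).congr_deriv ?_
    ring

theorem contDiffOn_moment (hUo : IsOpen U) (hU : U.OrdConnected) (hc : c ∈ U) (n : ℕ) :
    ∀ {φ : ℝ → ℝ}, ContDiffOn ℝ ∞ φ U → ∀ k : ℕ,
      ContDiffOn ℝ n (fun y => ∫ s in (0 : ℝ)..1, s ^ k * φ (c + s * (y - c))) U := by
  induction n with
  | zero =>
    intro φ hφ k
    refine contDiffOn_zero.2 fun x hx => ?_
    exact (hasDerivAt_moment hUo hU hc (hφ.of_le (by simp)) k hx).continuousAt.continuousWithinAt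
  | succ n ih =>
    intro φ hφ k
    have hD : ∀ x ∈ U, HasDerivAt _ _ x := fun x hx =>
      hasDerivAt_moment hUo hU hc (hφ.of_le (by simp)) k hx
    have hφ' : ContDiffOn ℝ ∞ (deriv φ) U := hφ.deriv_of_isOpen hUo le_rfl
    push_cast
    rw [contDiffOn_succ_iff_deriv_of_isOpen hUo]
    refine ⟨fun x hx => (hD x hx).differentiableAt.differentiableWithinAt, by simp, ?_⟩
    exact (ih hφ' (k + 1)).congr fun x hx => (hD x hx).deriv

/-- Hadamard's lemma on an open interval: the quotient is `u y = ∫₀¹ φ'(c + s(y - c)) ds`. -/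
theorem exists_eq_add_sub_mul (hUo : IsOpen U) (hU : U.OrdConnected) (hc : c ∈ U) {φ : ℝ → ℝ}
    (hφ : ContDiffOn ℝ ∞ φ U) :
    ∃ u : ℝ → ℝ, ContDiffOn ℝ ∞ u U ∧ ∀ x ∈ U, φ x = φ c + (x - c) * u x := by
  have hφ' : ContDiffOn ℝ ∞ (deriv φ) U := hφ.deriv_of_isOpen hUo le_rfl
  refine ⟨fun y => ∫ s in (0 : ℝ)..1, s ^ 0 * deriv φ (c + s * (y - c)),
    contDiffOn_infty.2 fun n => contDiffOn_moment hUo hU hc n hφ' 0, fun x hx => ?_⟩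
  have hd : ∀ s ∈ uIcc (0 : ℝ) 1,
      HasDerivAt (fun s => φ (c + s * (x - c)))
        ((x - c) * (s ^ 0 * deriv φ (c + s * (x - c)))) s := by
    intro s hs
    rw [uIcc_of_le zero_le_one] at hs
    have h1 := ((hφ.differentiableOn (by simp)).differentiableAt
      (hUo.mem_nhds (lineMap_mem hU hc hx hs))).hasDerivAt
    have h2 : HasDerivAt (fun s => c + s * (x - c)) (x - c) s := by
      simpa using ((hasDerivAt_id s).mul_const (x - c)).const_add c
    refine (h1.comp s h2).congr_deriv ?_
    ring
  have hint : IntervalIntegrable (fun s : ℝ => (x - c) * (s ^ 0 * deriv φ (c + s * (x - c))))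
      MeasureTheory.volume 0 1 := by
    apply ContinuousOn.intervalIntegrable
    rw [uIcc_of_le zero_le_one]
    exact continuousOn_const.mul (continuousOn_moment hU hc hφ'.continuousOn 0 hx)
  have := intervalIntegral.integral_eq_sub_of_hasDerivAt hd hint
  rw [intervalIntegral.integral_const_mul] at this
  simp only [this]
  simp

end Hadamard
/-! ### Power charts at points that are not flat -/

section FiniteOrder

variable {U : Set ℝ} {c : ℝ}

theorem iteratedDerivWithin_sub_mul (hU : IsOpen U) {v : ℝ → ℝ} (hv : ContDiffOn ℝ ∞ v U) (n : ℕ) :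
    ∀ x ∈ U, iteratedDerivWithin n (fun x => (x - c) * v x) U x =
      n * iteratedDerivWithin (n - 1) v U x + (x - c) * iteratedDerivWithin n v U x := by
  induction n with
  | zero => intro x _; simp
  | succ n ih =>
    intro x hx
    have hd : ∀ k : ℕ,
        HasDerivAt (iteratedDerivWithin k v U) (iteratedDerivWithin (k + 1) v U x) x := by
      intro k
      have h1 : DifferentiableOn ℝ (iteratedDerivWithin k v U) U :=
        hv.differentiableOn_iteratedDerivWithin (by exact_mod_cast ENat.natCast_lt_top k)
          hU.uniqueDiffOn
      rw [iteratedDerivWithin_succ, derivWithin_of_isOpen hU hx]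
      exact (h1.differentiableAt (hU.mem_nhds hx)).hasDerivAt
    have hsub : HasDerivAt (fun x : ℝ => x - c) 1 x := (hasDerivAt_id x).sub_const c
    have hn : HasDerivAt (fun x => (n : ℝ) * iteratedDerivWithin (n - 1) v U x)
        (n * iteratedDerivWithin n v U x) x := by
      rcases n with _ | n
      · simpa using hasDerivAt_const x (0 : ℝ)
      · exact (hd n).const_mul _
    rw [iteratedDerivWithin_succ, derivWithin_congr ih (ih x hx), derivWithin_of_isOpen hU hx,
      (hn.fun_add (hsub.fun_mul (hd n))).deriv]
    push_cast [Nat.add_sub_cancel]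
    ring

/-- A smooth function one of whose derivatives at `c` is nonzero is a power of `x - c` times a
smooth function that does not vanish at `c`. As long as the function vanishes at `c`, Hadamard's
lemma splits off a factor `x - c`, which lowers the order of the nonvanishing derivative. -/
theorem exists_eq_pow_mul (hUo : IsOpen U) (hU : U.OrdConnected) (hc : c ∈ U) (M : ℕ) :
    ∀ {φ : ℝ → ℝ}, ContDiffOn ℝ ∞ φ U → iteratedDerivWithin M φ U c ≠ 0 →
      ∃ (k : ℕ) (u : ℝ → ℝ), ContDiffOn ℝ ∞ u U ∧ u c ≠ 0 ∧ ∀ x ∈ U, φ x = (x - c) ^ k * u x := by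
  induction M with
  | zero =>
    intro φ hφ h
    exact ⟨0, φ, hφ, by simpa using h, by simp⟩
  | succ M ih =>
    intro φ hφ h
    by_cases h0 : φ c = 0
    · obtain ⟨v, hv, hφv⟩ := exists_eq_add_sub_mul hUo hU hc hφ
      simp only [h0, zero_add] at hφv
      rw [iteratedDerivWithin_congr hφv hc, iteratedDerivWithin_sub_mul hUo hv _ c hc] at h
      obtain ⟨k, u, hu, huc, hvu⟩ := ih hv (by rintro h'; simp [h'] at h)
      exact ⟨k + 1, u, hu, huc, fun x hx => by rw [hφv x hx, hvu x hx]; ring⟩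
    · exact ⟨0, φ, hφ, h0, by simp⟩

/-- The `C^∞` inverse function theorem with one open set `V` on which the inverse is smooth.
(Smoothness at the single point `g c` would give, for each finite order, a neighbourhood depending
on it.) -/
theorem exists_smooth_local_inverse {W : Set ℝ} (hW : IsOpen W) (hc : c ∈ W) {g : ℝ → ℝ}
    (hg : ContDiffOn ℝ ∞ g W) (hd : deriv g c ≠ 0) :
    ∃ (G : ℝ → ℝ) (V : Set ℝ), IsOpen V ∧ g c ∈ V ∧ ContDiffOn ℝ ∞ G V ∧ G (g c) = c ∧
      ∀ᶠ x in 𝓝 c, G (g x) = x := by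
  have hs : HasStrictDerivAt g (deriv g c) c :=
    (hg.contDiffAt (hW.mem_nhds hc)).hasStrictDerivAt (by simp)
  have hs' := hs.hasStrictFDerivAt_equiv hd
  set e := hs'.toOpenPartialHomeomorph g with he
  have hcoe : (e : ℝ → ℝ) = g := hs'.toOpenPartialHomeomorph_coe
  have hce : c ∈ e.source := hs'.mem_toOpenPartialHomeomorph_source
  have hce' : g c ∈ e.target := hcoe ▸ e.map_source hce
  have hinv : e.symm (g c) = c := by rw [← hcoe]; exact e.left_inv hce
  have hopen : IsOpen (W ∩ (deriv g) ⁻¹' {0}ᶜ) :=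
    (hg.continuousOn_deriv_of_isOpen hW (by simp)).isOpen_inter_preimage hW isOpen_compl_singleton
  refine ⟨e.symm, _, e.symm.isOpen_inter_preimage hopen, ⟨hce', ?_⟩, ?_, hinv, ?_⟩
  · rw [mem_preimage, hinv]
    exact ⟨hc, hd⟩
  · rintro y ⟨hy, hyW, hyd⟩
    have hsm := hg.contDiffAt (hW.mem_nhds hyW)
    refine (e.contDiffAt_symm_deriv hyd hy ?_ ?_).contDiffWithinAt
    · rw [hcoe]
      exact (hsm.differentiableAt (by simp)).hasDerivAt
    · rwa [hcoe]
  · filter_upwards [e.open_source.mem_nhds hce] with x hx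
    have := e.left_inv hx
    rwa [hcoe] at this

/-- Near a point `c` at which `f` is not flat, `|f x - f c| = |g x| ^ m` for a local coordinate `g`
vanishing at `c`, whose inverse `G` is smooth. Writing `f x - f c = (x - c) ^ m * u x` with
`u c ≠ 0`, one takes `g x = (x - c) * |u x| ^ (1 / m)`. -/
theorem exists_power_chart (hUo : IsOpen U) (hU : U.OrdConnected) (hc : c ∈ U) {f : ℝ → ℝ}
    (hf : ContDiffOn ℝ ∞ f U) (hflat : ∃ m : ℕ, 0 < m ∧ iteratedDerivWithin m f U c ≠ 0) :
    ∃ (m : ℕ) (g G : ℝ → ℝ) (V : Set ℝ), m ≠ 0 ∧ IsOpen V ∧ (0 : ℝ) ∈ V ∧ ContDiffOn ℝ ∞ G V ∧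
      G 0 = c ∧ ∀ᶠ x in 𝓝 c, G (g x) = x ∧ |f x - f c| = |g x| ^ m := by
  obtain ⟨M, hM, hMf⟩ := hflat
  have hφ : ContDiffOn ℝ ∞ (fun x => -f c + f x) U := contDiffOn_const.add hf
  obtain ⟨m, u, hu, huc, hfu⟩ := exists_eq_pow_mul hUo hU hc M hφ
    (by rwa [iteratedDerivWithin_const_add hM])
  have hm : m ≠ 0 := by
    rintro rfl
    exact huc (by simpa using (hfu c hc).symm)
  set W := U ∩ u ⁻¹' {0}ᶜ
  have hW : IsOpen W := hu.continuousOn.isOpen_inter_preimage hUo isOpen_compl_singleton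
  have hcW : c ∈ W := ⟨hc, huc⟩
  -- `|u x| ^ (1 / m)`, written with `u x ^ 2` so that its smoothness on `u ≠ 0` is immediate
  set r : ℝ → ℝ := fun x => (u x ^ 2) ^ ((2 * m : ℝ)⁻¹) with hr
  have hrs : ContDiffOn ℝ ∞ r W :=
    ((hu.mono inter_subset_left).pow 2).rpow_const_of_ne fun x hx => pow_ne_zero 2 hx.2
  have hrc : r c ≠ 0 := (Real.rpow_pos_of_pos (by positivity) _).ne'
  have hgs : ContDiffOn ℝ ∞ (fun x => (x - c) * r x) W :=
    (contDiffOn_id.sub contDiffOn_const).mul hrs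
  have hgd : HasDerivAt (fun x => (x - c) * r x) (r c) c := by
    have h1 : HasDerivAt (fun x : ℝ => x - c) 1 c := (hasDerivAt_id c).sub_const c
    have h2 := ((hrs.contDiffAt (hW.mem_nhds hcW)).differentiableAt (by simp)).hasDerivAt
    simpa using h1.fun_mul h2
  obtain ⟨G, V, hV, hcV, hG, hGc, hGg⟩ :=
    exists_smooth_local_inverse hW hcW hgs (by rwa [hgd.deriv])
  simp only [sub_self, zero_mul] at hcV hGc
  refine ⟨m, fun x => (x - c) * r x, G, V, hm, hV, hcV, hG, hGc, ?_⟩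
  filter_upwards [hGg, hUo.mem_nhds hc] with x hx hxU
  refine ⟨hx, ?_⟩
  have h1 : r x ^ m = |u x| := by
    rw [hr]
    simp only
    rw [← sq_abs, ← Real.rpow_natCast (|u x|) 2, ← Real.rpow_mul (abs_nonneg _),
      ← Real.rpow_mul_natCast (abs_nonneg _)]
    have : ((2 : ℕ) : ℝ) * (2 * m : ℝ)⁻¹ * m = 1 := by
      have : (m : ℝ) ≠ 0 := by exact_mod_cast hm
      push_cast
      field_simp
    rw [this, Real.rpow_one]
  have h2 : |r x| = r x := abs_of_nonneg (by positivity)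
  rw [← neg_add_eq_sub, hfu x hxU, abs_mul, abs_mul, abs_pow, mul_pow, h2, h1]

end FiniteOrder

/-! ### The order of the Fermat reals in terms of germs -/

section Germs

/-- `x` is less than `y` to first order at `0+`: the difference `y t - x t` is eventually at least
`κ * t` for some `κ > 0`. The linear margin makes the relation insensitive to changes of `x` and `y`
by `o(t)`; on little-oh polynomials it is the strict order of `•ℝ` (`mk_lt_mk_iff`). -/
def GermLT (x y : ℝ → ℝ) : Prop := ∃ κ : ℝ, 0 < κ ∧ ∀ᶠ t in 𝓝[>] (0 : ℝ), κ * t ≤ y t - x t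

theorem GermLT.eventually_lt {x y : ℝ → ℝ} (h : GermLT x y) : ∀ᶠ t in 𝓝[>] (0 : ℝ), x t < y t := by
  obtain ⟨κ, hκ, h⟩ := h
  filter_upwards [h, self_mem_nhdsWithin] with t ht h0
  have := mul_pos hκ h0
  linarith

theorem GermLT.congr {x x' y y' : ℝ → ℝ} (h : GermLT x y)
    (hx : (fun t : ℝ => x t - x' t) =o[𝓝[>] (0 : ℝ)] (fun t : ℝ => t))
    (hy : (fun t : ℝ => y t - y' t) =o[𝓝[>] (0 : ℝ)] (fun t : ℝ => t)) : GermLT x' y' := by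
  obtain ⟨κ, hκ, h⟩ := h
  refine ⟨κ / 2, by positivity, ?_⟩
  filter_upwards [h, (hx.sub hy).bound (half_pos hκ), self_mem_nhdsWithin] with t ht hb h0
  rw [Real.norm_eq_abs, Real.norm_of_nonneg (le_of_lt h0)] at hb
  have := (abs_le.1 hb).1
  linarith

theorem isLittleO_sub_self (x : ℝ → ℝ) :
    (fun t : ℝ => x t - x t) =o[𝓝[>] (0 : ℝ)] (fun t : ℝ => t) := by simp

theorem GermLT.not_isLittleO {x y : ℝ → ℝ} (h : GermLT x y) :
    ¬ (fun t : ℝ => x t - y t) =o[𝓝[>] (0 : ℝ)] (fun t : ℝ => t) := fun h' => by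
  obtain ⟨t, ht⟩ := (h.congr h' (isLittleO_sub_self y)).eventually_lt.exists
  exact lt_irrefl _ ht

/-- Splitting off the leading power of a sum of powers. For strictly increasing `a` all exponents
left in the second factor are positive; where `j ≤ i` the coefficient is `0` and the exponent `1` is a dummy. -/
theorem rpow_sum_eq_mul {k : ℕ} {a γ : Fin k → ℝ} (i : Fin k)
    (hγ : ∀ j < i, γ j = 0) {t : ℝ} (ht : 0 < t) :
    ∑ j, γ j * t ^ a j = t ^ a i *
      (γ i + ∑ j, (if i < j then γ j else 0) * t ^ (if i < j then a j - a i else 1)) := by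
  rw [mul_add, Finset.mul_sum, ← Finset.add_sum_erase _ _ (Finset.mem_univ i),
    ← Finset.add_sum_erase (a := i) _ (fun j => t ^ a i * _) (Finset.mem_univ i), mul_comm]
  simp only [lt_self_iff_false, if_false, zero_mul, mul_zero, zero_add]
  congr 1
  refine Finset.sum_congr rfl fun j hj => ?_
  rcases lt_or_gt_of_ne (Finset.ne_of_mem_erase hj) with h | h
  · simp [hγ j h, not_lt.2 h.le]
  · rw [if_pos h, if_pos h, Real.rpow_sub ht]
    have := (Real.rpow_pos_of_pos ht (a i)).ne'
    field_simp

theorem exists_mul_le_rpow_sum {k : ℕ} {a γ : Fin k → ℝ} (ha : StrictMono a) (i : Fin k)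
    (hi : a i ≤ 1) (hγ : ∀ j < i, γ j = 0) (hγi : 0 < γ i) :
    ∃ κ : ℝ, 0 < κ ∧ ∀ᶠ t in 𝓝[>] (0 : ℝ), κ * t ≤ ∑ j, γ j * t ^ a j := by
  refine ⟨γ i / 2, by positivity, ?_⟩
  have hS := tendsto_pow_sum (fun j => if i < j then γ j else 0)
    (fun j => if i < j then a j - a i else 1) (fun j => by
      split_ifs with h
      · exact sub_pos.2 (ha h)
      · exact one_pos)
  filter_upwards [hS.eventually_const_lt (show -(γ i / 2) < 0 by linarith),
    Ioo_mem_nhdsGT (zero_lt_one' ℝ)] with t hSt ht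
  rw [rpow_sum_eq_mul i hγ ht.1, mul_comm]
  have h1 : t ≤ t ^ a i := by
    simpa using Real.rpow_le_rpow_of_exponent_ge ht.1 ht.2.le hi
  exact mul_le_mul h1 (by linarith) (by positivity) (ht.1.le.trans h1)

theorem isLittleO_rpow_id {a : ℝ} (ha : 1 < a) :
    (fun t : ℝ => t ^ a) =o[𝓝[>] (0 : ℝ)] (fun t : ℝ => t) := by
  have h : (fun t : ℝ => t ^ (a - 1) * t) =o[𝓝[>] (0 : ℝ)] (fun t : ℝ => 1 * t) := by
    refine IsLittleO.mul_isBigO ?_ (isBigO_refl _ _)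
    rw [isLittleO_one_iff]
    have := (Real.continuousAt_rpow_const 0 (a - 1) (Or.inr (by linarith))).tendsto
    rw [Real.zero_rpow (by linarith)] at this
    exact this.mono_left nhdsWithin_le_nhds
  refine h.congr' ?_ (by simp)
  filter_upwards [self_mem_nhdsWithin] with t ht
  rw [← Real.rpow_add_one (ne_of_gt ht), sub_add_cancel]

/-- Collecting equal exponents: an expansion up to `o(t)` can be rewritten over any finite set `S`
of exponents, increasingly ordered, that contains all the given exponents `≤ 1`. -/
theorem isLittleO_sub_sum_orderEmbOfFin {x : ℝ → ℝ} {k : ℕ} {α a : Fin k → ℝ}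
    (h : (fun t : ℝ => x t - x 0 - ∑ i, α i * t ^ (a i)) =o[𝓝[>] (0 : ℝ)] (fun t : ℝ => t))
    (S : Finset ℝ) (hS : ∀ i, a i ≤ 1 → a i ∈ S) :
    (fun t : ℝ => x t - x 0 - ∑ j, (∑ i with a i = S.orderEmbOfFin rfl j, α i) *
      t ^ (S.orderEmbOfFin rfl j)) =o[𝓝[>] (0 : ℝ)] (fun t : ℝ => t) := by
  have h2 : (fun t : ℝ => ∑ i with ¬ a i ∈ S, α i * t ^ (a i)) =o[𝓝[>] (0 : ℝ)]
      (fun t : ℝ => t) := by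
    refine IsLittleO.fun_sum fun i hi => (isLittleO_rpow_id ?_).const_mul_left _
    by_contra! hle
    exact (Finset.mem_filter.1 hi).2 (hS i hle)
  refine (h.add h2).congr_left fun t => ?_
  have e1 : ∑ j, (∑ i with a i = S.orderEmbOfFin rfl j, α i) * t ^ (S.orderEmbOfFin rfl j) =
      ∑ e ∈ S, (∑ i with a i = e, α i) * t ^ e := by
    rw [← Finset.sum_coe_sort S (fun e => (∑ i with a i = e, α i) * t ^ e)]
    exact Fintype.sum_equiv (S.orderIsoOfFin rfl).toEquiv _ _ fun j => rfl
  have e2 : ∑ e ∈ S, (∑ i with a i = e, α i) * t ^ e = ∑ i with a i ∈ S, α i * t ^ (a i) := by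
    rw [← Finset.sum_fiberwise_of_maps_to (s := {i | a i ∈ S}) (t := S) (g := a)
      (fun i hi => (Finset.mem_filter.1 hi).2)]
    refine Finset.sum_congr rfl fun e he => ?_
    rw [Finset.sum_mul, Finset.filter_filter]
    have : ∀ i, (a i ∈ S ∧ a i = e) ↔ a i = e := fun i => ⟨And.right, fun h => ⟨h ▸ he, h⟩⟩
    simp only [this]
    refine Finset.sum_congr rfl fun i hi => ?_
    rw [(Finset.mem_filter.1 hi).2]
  rw [e1, e2, ← Finset.sum_filter_add_sum_filter_not Finset.univ (fun i => a i ∈ S)]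
  ring

theorem exists_common_exponents {U V : Set ℝ} {x y : ℝ → ℝ} (hx : IsLittleOhPoly U x)
    (hy : IsLittleOhPoly V y) :
    ∃ (k : ℕ) (e α β : Fin k → ℝ), StrictMono e ∧ (∀ i, e i ∈ Ioc (0 : ℝ) 1) ∧
      (fun t : ℝ => x t - x 0 - ∑ i, α i * t ^ (e i)) =o[𝓝[>] (0 : ℝ)] (fun t : ℝ => t) ∧
      (fun t : ℝ => y t - y 0 - ∑ i, β i * t ^ (e i)) =o[𝓝[>] (0 : ℝ)] (fun t : ℝ => t) := by
  classical
  obtain ⟨-, k, α, a, ha, hx⟩ := hx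
  obtain ⟨-, l, β, b, hb, hy⟩ := hy
  set S : Finset ℝ := (Finset.univ.image a ∪ Finset.univ.image b).filter (· ≤ 1) with hS
  have hS1 : ∀ e ∈ S, e ≤ 1 := fun e he => (Finset.mem_filter.1 he).2
  have hS0 : ∀ e ∈ S, 0 < e := fun e he => by
    have := (Finset.mem_filter.1 he).1
    simp only [Finset.mem_union, Finset.mem_image, Finset.mem_univ, true_and] at this
    rcases this with ⟨i, rfl⟩ | ⟨i, rfl⟩
    exacts [ha i, hb i]
  refine ⟨S.card, S.orderEmbOfFin rfl, _, _, (S.orderEmbOfFin rfl).strictMono, fun i => ?_,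
    isLittleO_sub_sum_orderEmbOfFin hx S (fun i hi => by simp [hS, hi]),
    isLittleO_sub_sum_orderEmbOfFin hy S (fun i hi => by simp [hS, hi])⟩
  have := S.orderEmbOfFin_mem rfl i
  exact ⟨hS0 _ this, hS1 _ this⟩

/-- The dictionary order of the coefficients decides the order of the germs, since the first
exponent at which the coefficients differ dominates. The standard part is treated as the
coefficient of `t ^ 0`. -/
theorem germLT_of_toLex_lt {x y : ℝ → ℝ} {k : ℕ} {e α β : Fin k → ℝ} (he : StrictMono e)
    (he1 : ∀ i, e i ∈ Ioc (0 : ℝ) 1)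
    (hx : (fun t : ℝ => x t - x 0 - ∑ i, α i * t ^ (e i)) =o[𝓝[>] (0 : ℝ)] (fun t : ℝ => t))
    (hy : (fun t : ℝ => y t - y 0 - ∑ i, β i * t ^ (e i)) =o[𝓝[>] (0 : ℝ)] (fun t : ℝ => t))
    (h : toLex (Fin.cons (x 0) α : Fin (k + 1) → ℝ) < toLex (Fin.cons (y 0) β : Fin (k + 1) → ℝ)) :
    GermLT x y := by
  obtain ⟨i, hlt, hi⟩ := h
  have hmono : StrictMono (Fin.cons 0 e : Fin (k + 1) → ℝ) :=
    Fin.strictMono_cons.2 ⟨fun _ => (he1 _).1, he⟩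
  have hle : ∀ j, (Fin.cons 0 e : Fin (k + 1) → ℝ) j ≤ 1 :=
    Fin.cases (by simp) (fun j => by simpa using (he1 j).2)
  obtain ⟨κ, hκ, hev⟩ := exists_mul_le_rpow_sum hmono i (hle i)
    (γ := fun j => (Fin.cons (y 0) β : Fin (k + 1) → ℝ) j - (Fin.cons (x 0) α : Fin (k + 1) → ℝ) j)
    (fun j hj => sub_eq_zero.2 (hlt j hj).symm) (sub_pos.2 hi)
  refine GermLT.congr (x := fun t => x 0 + ∑ i, α i * t ^ (e i))
    (y := fun t => y 0 + ∑ i, β i * t ^ (e i)) ⟨κ, hκ, ?_⟩ ?_ ?_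
  · filter_upwards [hev] with t ht
    refine ht.trans_eq ?_
    simp only [Fin.sum_univ_succ, Fin.cons_zero, Fin.cons_succ, Real.rpow_zero, mul_one, sub_mul,
      Finset.sum_sub_distrib]
  · exact hx.neg_left.congr_left fun t => by ring
  · exact hy.neg_left.congr_left fun t => by ring

theorem IsLittleOhPoly.apply_zero_eq {U V : Set ℝ} {x y : ℝ → ℝ} (hx : IsLittleOhPoly U x)
    (hy : IsLittleOhPoly V y)
    (h : (fun t : ℝ => x t - y t) =o[𝓝[>] (0 : ℝ)] (fun t : ℝ => t)) : x 0 = y 0 := by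
  have h1 := tendsto_nhds_unique (h.trans_tendsto tendsto_id_pos) (hx.tendsto.sub hy.tendsto)
  linarith

theorem isLittleO_of_toLex_eq {x y : ℝ → ℝ} {k : ℕ} {e α β : Fin k → ℝ}
    (hx : (fun t : ℝ => x t - x 0 - ∑ i, α i * t ^ (e i)) =o[𝓝[>] (0 : ℝ)] (fun t : ℝ => t))
    (hy : (fun t : ℝ => y t - y 0 - ∑ i, β i * t ^ (e i)) =o[𝓝[>] (0 : ℝ)] (fun t : ℝ => t))
    (h : toLex (Fin.cons (x 0) α : Fin (k + 1) → ℝ) = toLex (Fin.cons (y 0) β : Fin (k + 1) → ℝ)) :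
    (fun t : ℝ => x t - y t) =o[𝓝[>] (0 : ℝ)] (fun t : ℝ => t) := by
  obtain ⟨h0, rfl⟩ := Fin.cons_inj.1 (toLex.injective h)
  refine (hx.sub hy).congr_left fun t => ?_
  rw [h0]
  ring

/-- Any two little-oh polynomials are comparable to first order. This is the tameness on which the
intermediate value property rests: `x t ≤ y t` for arbitrarily small `t > 0` rules out that `y` is
less than `x`. -/
theorem germ_trichotomy {U V : Set ℝ} {x y : ℝ → ℝ} (hx : IsLittleOhPoly U x)
    (hy : IsLittleOhPoly V y) :
    GermLT x y ∨ (fun t : ℝ => x t - y t) =o[𝓝[>] (0 : ℝ)] (fun t : ℝ => t) ∨ GermLT y x := by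
  obtain ⟨k, e, α, β, he, he1, hxe, hye⟩ := exists_common_exponents hx hy
  rcases lt_trichotomy (toLex (Fin.cons (x 0) α : Fin (k + 1) → ℝ))
    (toLex (Fin.cons (y 0) β : Fin (k + 1) → ℝ)) with h | h | h
  · exact Or.inl (germLT_of_toLex_lt he he1 hxe hye h)
  · exact Or.inr (Or.inl (isLittleO_of_toLex_eq hxe hye h))
  · exact Or.inr (Or.inr (germLT_of_toLex_lt he he1 hye hxe h))

/-- The class in `•U` of a little-oh polynomial on `U`. -/
def mk {U : Set ℝ} (p : LittleOhPoly U) : Ext U := Quotient.mk (littleOhSetoid U) p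

theorem mk_eq_mk_iff {U : Set ℝ} {p q : LittleOhPoly U} :
    mk p = mk q ↔
      (fun t : ℝ => p.1 t - q.1 t) =o[𝓝[>] (0 : ℝ)] (fun t : ℝ => t) :=
  Quotient.eq.trans ⟨And.right, fun h => ⟨p.2.apply_zero_eq q.2 h, h⟩⟩

theorem IsQuasiDecomp.isLittleO {U : Set ℝ} {p : LittleOhPoly U} {k : ℕ} {a α : Fin k → ℝ}
    (h : IsQuasiDecomp (mk p) a α) :
    (fun t : ℝ => p.1 t - p.1 0 - ∑ i, α i * t ^ (a i)) =o[𝓝[>] (0 : ℝ)] (fun t : ℝ => t) := by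
  obtain ⟨-, -, q, hq, h⟩ := h
  have h1 := mk_eq_mk_iff.1 hq
  have h0 := q.2.apply_zero_eq p.2 h1
  refine (h.sub h1).congr_left fun t => ?_
  rw [h0]
  ring

theorem mk_lt_mk_iff {U : Set ℝ} {p q : LittleOhPoly U} :
    mk p < mk q ↔ GermLT p.1 q.1 := by
  constructor
  · rintro ⟨⟨k, e, α, β, hp, hq, hle⟩, hne⟩
    rcases hle.lt_or_eq with h | h
    · exact germLT_of_toLex_lt hp.1 hp.2.1 hp.isLittleO hq.isLittleO h
    · exact absurd (mk_eq_mk_iff.2 (isLittleO_of_toLex_eq hp.isLittleO hq.isLittleO h)) hne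
  · intro h
    refine ⟨?_, fun heq => h.not_isLittleO (mk_eq_mk_iff.1 heq)⟩
    obtain ⟨k, e, α, β, he, he1, hp, hq⟩ := exists_common_exponents p.2 q.2
    refine ⟨k, e, α, β, ⟨he, he1, p, rfl, hp⟩, ⟨he, he1, q, rfl, hq⟩, ?_⟩
    by_contra hlt
    have h' := germLT_of_toLex_lt he he1 hq hp (not_le.1 hlt)
    obtain ⟨t, ht, ht'⟩ := (h.eventually_lt.and h'.eventually_lt).exists
    exact lt_asymm ht ht'

end Germs

/-! ### Roots of sums of powers -/

section Roots

/-- Membership in `approxAlg` ignores the value at `0`, so being a little-oh polynomial also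
requires that this value be the limit at `0+`. -/
theorem isLittleOhPoly_of_mem_approxAlg {U : Set ℝ} {x : ℝ → ℝ} (hx : x ∈ approxAlg)
    (hlim : Tendsto x (𝓝[>] 0) (𝓝 (x 0))) (hU : U ∈ 𝓝 (x 0)) : IsLittleOhPoly U x := by
  constructor
  · obtain ⟨ε, hε, h⟩ := mem_nhdsGT_iff_exists_Ioo_subset.1 (hlim hU)
    refine ⟨ε, hε, fun t ht => ?_⟩
    rcases ht.1.eq_or_lt with rfl | h0
    · exact mem_of_mem_nhds hU
    · exact h ⟨h0, ht.2⟩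
  · obtain ⟨p, hp, hxp⟩ := hx
    obtain ⟨c, k, α, a, ha, hpt⟩ := powAlg_normal_form hp
    have h : (fun t => x t - c - ∑ i, α i * t ^ (a i)) =o[𝓝[>] (0 : ℝ)] (fun t : ℝ => t) := by
      refine hxp.congr' ?_ EventuallyEq.rfl
      filter_upwards [self_mem_nhdsWithin] with t ht
      rw [hpt t, abs_of_pos ht, sub_sub]
    have hc : x 0 = c := by
      have h2 := ((h.trans_tendsto tendsto_id_pos).add (tendsto_pow_sum α a ha)).add_const c
      refine tendsto_nhds_unique hlim ?_
      simpa using h2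
    exact ⟨k, α, a, ha, by rwa [hc]⟩

theorem isLittleOhPoly_const_add_rpow_sum {U : Set ℝ} {k : ℕ} (c : ℝ) (α a : Fin k → ℝ)
    (ha : ∀ i, 0 < a i) (hU : U ∈ 𝓝 c) :
    IsLittleOhPoly U (fun t => c + ∑ i, α i * t ^ (a i)) := by
  have h0 : c + ∑ i, α i * (0 : ℝ) ^ (a i) = c := by simp [Real.zero_rpow (ha _).ne']
  have hx : IsLittleOhPoly univ (fun t => c + ∑ i, α i * t ^ (a i)) :=
    ⟨⟨1, one_pos, fun _ _ => mem_univ _⟩, k, α, a, ha, by simp [h0]⟩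
  exact isLittleOhPoly_of_mem_approxAlg hx.mem_approxAlg hx.tendsto (by simpa only [h0] using hU)

/-- The `m`-th root of the absolute value of a sum of powers is a little-oh polynomial. Exactness
of the sum matters: an error `o(t)` under the root could cause an error larger than `o(t)`. The leading
power `t ^ a` contributes `t ^ (a / m)`, and the remaining factor is bounded away from `0`, where
the root is smooth. -/
theorem exists_abs_rpow_sum_root {k : ℕ} (α a : Fin k → ℝ) (ha : StrictMono a)
    (ha0 : ∀ i, 0 < a i) {m : ℕ} (hm : m ≠ 0) :
    ∃ w : ℝ → ℝ, IsLittleOhPoly univ w ∧ w 0 = 0 ∧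
      ∀ᶠ t in 𝓝[>] (0 : ℝ), 0 ≤ w t ∧ w t ^ m = |∑ i, α i * t ^ (a i)| := by
  by_cases hα : ∃ i, α i ≠ 0
  swap
  · push Not at hα
    refine ⟨fun _ => 0, ⟨⟨1, one_pos, fun _ _ => mem_univ _⟩, 0, 0, 0, by simp, by simp⟩, rfl, ?_⟩
    simp [hα, hm]
  classical
  obtain ⟨i, hi, hmin⟩ := WellFounded.has_min (wellFounded_lt (α := Fin k)) {i | α i ≠ 0} hα
  have hzero : ∀ j < i, α j = 0 := fun j hj => by
    by_contra h
    exact hmin j h hj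
  have hpos : ∀ j, 0 < (if i < j then a j - a i else 1) := fun j => by
    split_ifs with h
    · exact sub_pos.2 (ha h)
    · exact one_pos
  -- `∑ j, α j * t ^ a j = t ^ a i * s t` with `s 0 = α i ≠ 0`
  set s : ℝ → ℝ := fun t => α i + ∑ j, (if i < j then α j else 0) *
    t ^ (if i < j then a j - a i else 1) with hs
  have hsP : IsLittleOhPoly {0}ᶜ s := isLittleOhPoly_const_add_rpow_sum (α i) _ _ hpos
    (isOpen_compl_singleton.mem_nhds hi)
  have hr : ContDiffOn ℝ ∞ (fun v : ℝ => (v ^ 2) ^ ((2 * m : ℝ)⁻¹)) {0}ᶜ :=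
    (contDiffOn_id.pow 2).rpow_const_of_ne fun v hv => pow_ne_zero 2 hv
  have hrs := hsP.comp isOpen_compl_singleton hr
  have hm' : (0 : ℝ) < m := by exact_mod_cast Nat.pos_of_ne_zero hm
  have hmpos : 0 < a i / m := div_pos (ha0 i) hm'
  have hpow : IsLittleOhPoly univ (fun t : ℝ => t ^ (a i / m)) := by
    simpa using isLittleOhPoly_const_add_rpow_sum (U := univ) (k := 1) 0 (fun _ => 1)
      (fun _ => a i / m) (fun _ => hmpos) univ_mem
  refine ⟨_, isLittleOhPoly_of_mem_approxAlg (mul_mem hpow.mem_approxAlg hrs.mem_approxAlg)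
    (hpow.tendsto.mul hrs.tendsto) univ_mem, ?_, ?_⟩
  · simp [Real.zero_rpow hmpos.ne']
  · filter_upwards [self_mem_nhdsWithin] with t ht
    have ht : 0 < t := ht
    rw [rpow_sum_eq_mul i hzero ht, Pi.mul_apply]
    refine ⟨by positivity, ?_⟩
    change (t ^ (a i / m) * (s t ^ 2) ^ ((2 * m : ℝ)⁻¹)) ^ m = |t ^ a i * s t|
    rw [mul_pow, abs_mul, abs_of_pos (Real.rpow_pos_of_pos ht _), ← Real.rpow_mul_natCast ht.le,
      div_mul_cancel₀ _ hm'.ne', ← sq_abs, ← Real.rpow_natCast |s t| 2,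
      ← Real.rpow_mul (abs_nonneg _), ← Real.rpow_mul_natCast (abs_nonneg _)]
    have : ((2 : ℕ) : ℝ) * (2 * m : ℝ)⁻¹ * m = 1 := by
      push_cast
      field_simp
    rw [this, Real.rpow_one]

end Roots

/-! ### The intermediate value property -/

/-- If the values `c t` solve `f (c t) = f c₀ + ∑ i, α i * t ^ a i` and tend to `c₀` along an
ultrafilter finer than `𝓝[>] 0`, then along it they agree with a little-oh polynomial. In a power
chart at `c₀` the equation reads `|g (c t)| ^ m = |∑ i, α i * t ^ a i|`, so that `g (c t)` is plus
or minus an `m`-th root; an ultrafilter selects the sign. -/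
theorem exists_branch_of_power_chart {k : ℕ} {α a : Fin k → ℝ} (ha : StrictMono a)
    (ha0 : ∀ i, 0 < a i) {U : Set ℝ} (hUo : IsOpen U) (hU : U.OrdConnected) {f : ℝ → ℝ}
    (hf : ContDiffOn ℝ ∞ f U) {c₀ : ℝ} (hc₀ : c₀ ∈ U)
    (hflat : ∃ m : ℕ, 0 < m ∧ iteratedDerivWithin m f U c₀ ≠ 0)
    {L : Ultrafilter ℝ} (hL : (L : Filter ℝ) ≤ 𝓝[>] 0) {c : ℝ → ℝ} (hc : Tendsto c L (𝓝 c₀))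
    (hfc : ∀ᶠ t in L, f (c t) = f c₀ + ∑ i, α i * t ^ (a i)) :
    ∃ C : ℝ → ℝ, IsLittleOhPoly U C ∧ ∀ᶠ t in L, C t = c t := by
  obtain ⟨m, g, G, V, hm, hV, h0V, hG, hG0, hev⟩ := exists_power_chart hUo hU hc₀ hf hflat
  obtain ⟨w, hw, hw0, hwm⟩ := exists_abs_rpow_sum_root α a ha ha0 hm
  have hbranch : ∀ σ : ℝ, IsLittleOhPoly U (fun t => G (σ * w t)) := fun σ => by
    have hσ : IsLittleOhPoly V (fun t => σ * w t) := by
      refine isLittleOhPoly_of_mem_approxAlg (Subalgebra.smul_mem _ hw.mem_approxAlg σ)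
        (hw.tendsto.const_mul σ) ?_
      simpa [hw0] using hV.mem_nhds h0V
    have hGσ := hσ.comp hV hG
    refine isLittleOhPoly_of_mem_approxAlg hGσ.mem_approxAlg hGσ.tendsto ?_
    simpa [hw0, hG0] using hUo.mem_nhds hc₀
  have hsign : ∀ᶠ t in L, G (1 * w t) = c t ∨ G (-1 * w t) = c t := by
    filter_upwards [hc.eventually hev, hfc, hL hwm] with t ht hft hwt
    rw [hft, add_sub_cancel_left, ← hwt.2] at ht
    have habs : w t = |g (c t)| := (pow_left_inj₀ hwt.1 (abs_nonneg _) hm).1 ht.2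
    rw [habs]
    rcases abs_choice (g (c t)) with h | h
    · left; rw [h, one_mul, ht.1]
    · right; rw [h, neg_one_mul, neg_neg, ht.1]
  rcases Ultrafilter.eventually_or.1 hsign with h | h
  exacts [⟨_, hbranch 1, h⟩, ⟨_, hbranch (-1), h⟩]

/-- The intermediate value property for representatives, the intermediate value being represented
by a constant plus an exact sum of powers. -/
theorem exists_germ_solution {U : Set ℝ} (hUo : IsOpen U) (hU : U.OrdConnected) {f : ℝ → ℝ}
    (hf : ContDiffOn ℝ ∞ f U)
    (hflat : ∀ u ∈ U, ∃ m : ℕ, 0 < m ∧ iteratedDerivWithin m f U u ≠ 0)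
    {p q : ℝ → ℝ} (hp : IsLittleOhPoly U p) (hq : IsLittleOhPoly U q) (hpq : GermLT p q)
    {k : ℕ} {y₀ : ℝ} {α a : Fin k → ℝ} (ha : StrictMono a) (ha0 : ∀ i, 0 < a i)
    (hy : (GermLT (fun t => f (p t)) (fun t => y₀ + ∑ i, α i * t ^ (a i)) ∧
        GermLT (fun t => y₀ + ∑ i, α i * t ^ (a i)) (fun t => f (q t))) ∨
      (GermLT (fun t => f (q t)) (fun t => y₀ + ∑ i, α i * t ^ (a i)) ∧
        GermLT (fun t => y₀ + ∑ i, α i * t ^ (a i)) (fun t => f (p t)))) :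
    ∃ C : ℝ → ℝ, IsLittleOhPoly U C ∧ GermLT p C ∧ GermLT C q ∧
      (fun t => f (C t) - (y₀ + ∑ i, α i * t ^ (a i))) =o[𝓝[>] (0 : ℝ)] (fun t : ℝ => t) := by
  set y : ℝ → ℝ := fun t => y₀ + ∑ i, α i * t ^ (a i) with hydef
  have hyP : IsLittleOhPoly univ y := isLittleOhPoly_const_add_rpow_sum y₀ α a ha0 univ_mem
  have hy0 : y 0 = y₀ := by simp [hydef, Real.zero_rpow (ha0 _).ne']
  -- the real intermediate value theorem, applied for each small `t`
  have hivt : ∀ᶠ t in 𝓝[>] (0 : ℝ), ∃ c, c ∈ Ioo (p t) (q t) ∧ f c = y t := by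
    filter_upwards [hpq.eventually_lt, hp.tendsto (hUo.mem_nhds hp.mem_zero),
      hq.tendsto (hUo.mem_nhds hq.mem_zero),
      show ∀ᶠ t in 𝓝[>] (0 : ℝ), (f (p t) < y t ∧ y t < f (q t)) ∨
          (f (q t) < y t ∧ y t < f (p t)) from
        hy.elim (fun h => (h.1.eventually_lt.and h.2.eventually_lt).mono fun _ => Or.inl)
          (fun h => (h.1.eventually_lt.and h.2.eventually_lt).mono fun _ => Or.inr)]
      with t hlt hpt hqt hyt
    have hcont : ContinuousOn f (Icc (p t) (q t)) := hf.continuousOn.mono (hU.out hpt hqt)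
    rcases hyt with h | h
    · exact intermediate_value_Ioo hlt.le hcont h
    · exact intermediate_value_Ioo' hlt.le hcont h
  obtain ⟨c, hc⟩ := hivt.choice
  -- `c` need not have a limit at `0+`; along an ultrafilter it has one
  set L : Ultrafilter ℝ := Ultrafilter.of (𝓝[>] (0 : ℝ))
  have hL : (L : Filter ℝ) ≤ 𝓝[>] 0 := Ultrafilter.of_le _
  have hcL : ∀ᶠ t in L, c t ∈ Ioo (p t) (q t) ∧ f (c t) = y t := hL hc
  have hpL := hp.tendsto.mono_left hL
  have hqL := hq.tendsto.mono_left hL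
  obtain ⟨c₀, hc₀⟩ : ∃ c₀, Tendsto c L (𝓝 c₀) := by
    have hK : ∀ᶠ t in L, c t ∈ Icc (p 0 - 1) (q 0 + 1) := by
      filter_upwards [hcL, hpL.eventually_const_lt (sub_one_lt (p 0)),
        hqL.eventually_lt_const (lt_add_one (q 0))] with t ht h1 h2
      exact ⟨h1.le.trans ht.1.1.le, ht.1.2.le.trans h2.le⟩
    obtain ⟨c₀, -, h⟩ := isCompact_Icc.ultrafilter_le_nhds' (L.map c) hK
    exact ⟨c₀, h⟩
  have hc₀U : c₀ ∈ U := by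
    refine hU.out hp.mem_zero hq.mem_zero ⟨le_of_tendsto_of_tendsto hpL hc₀ ?_,
      le_of_tendsto_of_tendsto hc₀ hqL ?_⟩
    · filter_upwards [hcL] with t ht using ht.1.1.le
    · filter_upwards [hcL] with t ht using ht.1.2.le
  have hfc₀ : f c₀ = y₀ := by
    rw [← hy0]
    refine tendsto_nhds_unique
      ((hf.continuousOn.continuousAt (hUo.mem_nhds hc₀U)).tendsto.comp hc₀) ?_
    refine (hyP.tendsto.mono_left hL).congr' ?_
    filter_upwards [hcL] with t ht using ht.2.symm
  obtain ⟨C, hC, hCc⟩ := exists_branch_of_power_chart ha ha0 hUo hU hf hc₀U (hflat c₀ hc₀U) hL hc₀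
    (hcL.mono fun t ht => by rw [ht.2, hfc₀])
  have hCL : ∀ᶠ t in L, p t < C t ∧ C t < q t ∧ f (C t) = y t := by
    filter_upwards [hcL, hCc] with t ht h
    rw [h]
    exact ⟨ht.1.1, ht.1.2, ht.2⟩
  -- a strict inequality between germs cannot be reversed along `L`
  have hno : ∀ {u v : ℝ → ℝ}, GermLT u v → ¬ ∀ᶠ t in L, v t ≤ u t := fun h h' => by
    obtain ⟨t, ht, ht'⟩ := (h'.and (hL h.eventually_lt)).exists
    exact ht.not_gt ht'
  have hfC : (fun t => f (C t) - y t) =o[𝓝[>] (0 : ℝ)] (fun t : ℝ => t) := by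
    rcases germ_trichotomy (hC.comp hUo hf) hyP with h | h | h
    · exact absurd (hCL.mono fun t ht => ht.2.2.ge) (hno h)
    · exact h
    · exact absurd (hCL.mono fun t ht => ht.2.2.le) (hno h)
  -- `x = p` and `x = q` are not equivalent to `C`, because `f ∘ x` is not equivalent to `f ∘ C`
  have hne : ∀ {x : ℝ → ℝ}, IsLittleOhPoly U x →
      (GermLT (fun t => f (x t)) y ∨ GermLT y (fun t => f (x t))) →
      ¬ (fun t : ℝ => x t - C t) =o[𝓝[>] (0 : ℝ)] (fun t : ℝ => t) := fun hx hxy h => by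
    have hxC := comp_equiv hUo hf hx hC (hx.apply_zero_eq hC h) h
    rcases hxy with h' | h'
    · exact h'.not_isLittleO (by simpa using hxC.add hfC)
    · exact h'.not_isLittleO (by simpa using (hxC.add hfC).neg_left)
  refine ⟨C, hC, ?_, ?_, hfC⟩
  · rcases germ_trichotomy hp hC with h | h | h
    · exact h
    · exact absurd h (hne hp (hy.imp And.left And.right))
    · exact absurd (hCL.mono fun t ht => ht.1.le) (hno h)
  · rcases germ_trichotomy hq hC with h | h | h
    · exact absurd (hCL.mono fun t ht => ht.2.1.le) (hno h)
    · exact absurd h (hne hq (hy.symm.imp And.left And.right))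
    · exact h

/-- The little-oh polynomial `f ∘ x`, which represents `•f` at the class of `x`. -/
def LittleOhPoly.comp {U : Set ℝ} (x : LittleOhPoly U) {f : ℝ → ℝ} (hU : IsOpen U)
    (hf : ContDiffOn ℝ ∞ f U) : LittleOhPoly univ :=
  ⟨fun t => f (x.1 t), x.2.comp hU hf⟩

theorem extend_mk {U : Set ℝ} {f : ℝ → ℝ} (hU : IsOpen U) (hf : ContDiffOn ℝ ∞ f U)
    (x : LittleOhPoly U) : extend f hU hf (mk x) = mk (x.comp hU hf) := rfl

end Fermat

theorem mainTheorem2 (U : Set ℝ) (hU : IsOpen U) (hconn : IsPreconnected U) (f : ℝ → ℝ)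
    (hf : ContDiffOn ℝ ∞ f U)
    (hflat : ∀ u ∈ U, ∃ m : ℕ, 0 < m ∧ iteratedDerivWithin m f U u ≠ 0) :
    Fermat.HasIntermediateValueProperty (Fermat.extend f hU hf) := by
  intro a b hab y hy
  obtain ⟨p, rfl⟩ : ∃ p, Fermat.mk p = a := Quotient.exists_rep a
  obtain ⟨q, rfl⟩ : ∃ q, Fermat.mk q = b := Quotient.exists_rep b
  obtain ⟨r, rfl⟩ : ∃ r, Fermat.mk r = y := Quotient.exists_rep y
  obtain ⟨k, e, α, -, he, he1, hr, -⟩ := Fermat.exists_common_exponents r.2 r.2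
  simp only [Fermat.extend_mk, Fermat.mk_lt_mk_iff] at hy hab
  have hr' : (fun t => r.1 t - (r.1 0 + ∑ i, α i * t ^ (e i))) =o[𝓝[>] (0 : ℝ)]
      (fun t : ℝ => t) := hr.congr_left fun t => sub_sub _ _ _
  obtain ⟨C, hC, hpC, hCq, hfC⟩ := Fermat.exists_germ_solution hU hconn.ordConnected hf hflat
    p.2 q.2 hab (y₀ := r.1 0) (α := α) he (fun i => (he1 i).1)
    (hy.imp (fun h => ⟨h.1.congr (Fermat.isLittleO_sub_self _) hr',
        h.2.congr hr' (Fermat.isLittleO_sub_self _)⟩)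
      (fun h => ⟨h.1.congr (Fermat.isLittleO_sub_self _) hr',
        h.2.congr hr' (Fermat.isLittleO_sub_self _)⟩))
  let c : Fermat.LittleOhPoly U := ⟨C, hC⟩
  refine ⟨Fermat.mk c, Fermat.mk_lt_mk_iff.2 hpC, Fermat.mk_lt_mk_iff.2 hCq, ?_⟩
  rw [Fermat.extend_mk, Fermat.mk_eq_mk_iff]
  exact (hfC.sub hr').congr_left fun t => sub_sub_sub_cancel_right _ _ _
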